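/- Let $\mathbb{D}=\{z\in\mathbb{C}:|z|<1\}$ and, for $f:\mathbb{D}\to\mathbb{C}$, let $$B_f=\sup_{z,w\in\mathbb{D},\ z\neq w}\frac{|f(z)-f(w)|}{\rho(z,w)}\in[0,\infty],\qquad \rho(z,w)=\frac12\log\left(\frac{1+\left|\frac{z-w}{1-\overline{z}w}\right|}{1-\left|\frac{z-w}{1-\overline{z}w}\right|}\right).$$ Let $f(z)=H(z)+|z|^2G(z)$ be a biharmonic mapping of $\mathbb{D}$, where $H$ and $G$ are complex-valued harmonic functions on $\mathbb{D}$, and suppose that $B_f<\infty$. Then, with $\partial_z=\frac12(\partial_x-i\partial_y)$ and $\partial_{\overline z}=\frac12(\partial_x+i\partial_y)$ denoted by subscripts, $$B_f\ \ge\ \sup_{z\in\mathbb{D}}(1-|z|^2)\,\Big|\,\big|H_z(z)+|z|^2G_z(z)\big|-\big|H_{\overline z}(z)+|z|^2G_{\overline z}(z)\big|\,\Big|.$$ If, in addition, $M$ is a real number such that $|H(z)|\le M$ and $|G(z)|\le M$ for all $z\in\mathbb{D}$, then $$B_f\ \le\ \frac{4M}{27\pi^3}\left(8+36\pi^2+(4+3\pi^2)^{3/2}\right).$$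 Moreover, the numerical constant satisfies $\left|\frac{4}{27\pi^3}\left(8+36\pi^2+(4+3\pi^2)^{3/2}\right)-2.67\right|<0.005$. -/

import Mathlib

open scoped ENNReal ComplexConjugate

noncomputable section

/-- The Wirtinger derivative `f_z = (f_x - i f_y) / 2`. -/
def wirtingerZ (f : ℂ → ℂ) (z : ℂ) : ℂ :=
  (1 / 2) * (fderiv ℝ f z 1 - Complex.I * fderiv ℝ f z Complex.I)

/-- The conjugate Wirtinger derivative `f_{z̄} = (f_x + i f_y) / 2`. -/
def wirtingerZBar (f : ℂ → ℂ) (z : ℂ) : ℂ :=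
  (1 / 2) * (fderiv ℝ f z 1 + Complex.I * fderiv ℝ f z Complex.I)

/-- The hyperbolic distance of the unit disk, with density `1 / (1 - |z|²)`
(meaningful for `z` and `w` in the open unit disk). -/
def diskHypDist (z w : ℂ) : ℝ :=
  (1 / 2) * Real.log ((1 + ‖(z - w) / (1 - conj z * w)‖) / (1 - ‖(z - w) / (1 - conj z * w)‖))

/-- The Bloch number `B_f`, as an extended nonnegative real: the supremum of
`|f z - f w| / ρ(z, w)` over distinct points `z`, `w` of the open unit disk. -/
def blochNumber (f : ℂ → ℂ) : ℝ≥0∞ :=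
  ⨆ (z ∈ Metric.ball (0 : ℂ) 1) (w ∈ Metric.ball (0 : ℂ) 1) (_ : z ≠ w),
    ENNReal.ofReal (‖f z - f w‖ / diskHypDist z w)

end

/-! `B_f` controls, and is controlled by, the hyperbolic derivative `(1 - |z|²) ‖df_z‖`, and `‖df_z‖
= |f_z| + |f_z̄|`. One direction lets `w → z` along a line (`norm_fderiv_le_blochNumber`); the other
integrates along a geodesic (`norm_sub_le_mul_diskHypDist`).

Lower bound: `f_z = H_z + |z|² G_z + z̄ G` and `f_z̄ = H_z̄ + |z|² G_z̄ + z G`. The terms in `G`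
have equal modulus, so they cancel from a difference of moduli.

Upper bound: Schwarz–Pick applied to the tangent of a holomorphic map into a strip gives `4M/π` for
`H` and for `G` (`norm_fderiv_le_of_harmonicOnNhd`). With `x = |z|` the total is `M (4/π (1 + x²) +
2x (1 - x²))`, and the stated constant is the maximum of this cubic over `x ≥ 0` when `M = 1`. -/

/-! ### Disk automorphisms and Schwarz–Pick. -/

/-- The disk automorphism `ζ ↦ (ζ + a) / (1 + ā ζ)`. -/
noncomputable def diskMobius (a ζ : ℂ) : ℂ := (ζ + a) / (1 + conj a * ζ)

theorem one_add_conj_mul_ne_zero {a ζ : ℂ} (ha : ‖a‖ < 1) (hζ : ‖ζ‖ < 1) :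
    1 + conj a * ζ ≠ 0 := by
  intro h
  have h1 : conj a * ζ = -1 := by linear_combination h
  have h2 : ‖a‖ * ‖ζ‖ = 1 := by simpa using congrArg norm h1
  nlinarith [norm_nonneg a, norm_nonneg ζ]

theorem norm_sq_one_add_conj_mul_sub (a ζ : ℂ) :
    ‖1 + conj a * ζ‖ ^ 2 - ‖ζ + a‖ ^ 2 = (1 - ‖a‖ ^ 2) * (1 - ‖ζ‖ ^ 2) := by
  simp only [Complex.sq_norm, Complex.normSq_apply]
  simp
  ring

theorem one_sub_norm_sq_diskMobius {a ζ : ℂ} (ha : ‖a‖ < 1) (hζ : ‖ζ‖ < 1) :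
    1 - ‖diskMobius a ζ‖ ^ 2 = (1 - ‖a‖ ^ 2) * (1 - ‖ζ‖ ^ 2) / ‖1 + conj a * ζ‖ ^ 2 := by
  have h : ‖1 + conj a * ζ‖ ≠ 0 := norm_ne_zero_iff.2 (one_add_conj_mul_ne_zero ha hζ)
  rw [← norm_sq_one_add_conj_mul_sub, diskMobius, norm_div, div_pow, sub_div,
    div_self (pow_ne_zero 2 h)]

theorem one_sub_norm_sq_pos {a : ℂ} (ha : ‖a‖ < 1) : 0 < 1 - ‖a‖ ^ 2 := by
  nlinarith [norm_nonneg a]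

theorem norm_diskMobius_lt_one {a ζ : ℂ} (ha : ‖a‖ < 1) (hζ : ‖ζ‖ < 1) :
    ‖diskMobius a ζ‖ < 1 := by
  have h : 0 < ‖1 + conj a * ζ‖ := norm_pos_iff.2 (one_add_conj_mul_ne_zero ha hζ)
  have h1 : 0 < 1 - ‖diskMobius a ζ‖ ^ 2 := by
    rw [one_sub_norm_sq_diskMobius ha hζ]
    have := one_sub_norm_sq_pos ha
    have := one_sub_norm_sq_pos hζ
    positivity
  nlinarith [norm_nonneg (diskMobius a ζ)]

theorem hasDerivAt_diskMobius {a ζ : ℂ} (ha : ‖a‖ < 1) (hζ : ‖ζ‖ < 1) :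
    HasDerivAt (diskMobius a) (((1 - ‖a‖ ^ 2 : ℝ) : ℂ) / (1 + conj a * ζ) ^ 2) ζ := by
  have h := one_add_conj_mul_ne_zero ha hζ
  have h1 : HasDerivAt (fun ζ : ℂ => ζ + a) 1 ζ := (hasDerivAt_id ζ).add_const a
  have h2 : HasDerivAt (fun ζ : ℂ => 1 + conj a * ζ) (conj a) ζ := by
    simpa using ((hasDerivAt_id ζ).const_mul (conj a)).const_add 1
  refine (h1.div h2 h).congr_deriv ?_
  push_cast
  rw [← Complex.conj_mul' a]
  ring

theorem diskMobius_zero (a : ℂ) : diskMobius a 0 = a := by simp [diskMobius]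

theorem diskMobius_neg_self (a : ℂ) : diskMobius (-a) a = 0 := by simp [diskMobius]

/-- The Schwarz–Pick inequality for the derivative. -/
theorem schwarzPick_deriv {φ : ℂ → ℂ} (hd : DifferentiableOn ℂ φ (Metric.ball 0 1))
    (hm : ∀ z : ℂ, ‖z‖ < 1 → ‖φ z‖ < 1) {z : ℂ} (hz : ‖z‖ < 1) :
    (1 - ‖z‖ ^ 2) * ‖deriv φ z‖ ≤ 1 - ‖φ z‖ ^ 2 := by
  have hpz := one_sub_norm_sq_pos hz
  have hpa := one_sub_norm_sq_pos (hm z hz)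
  have hma : ‖-φ z‖ < 1 := by simpa using hm z hz
  have hdφ : ∀ ζ : ℂ, ‖ζ‖ < 1 → HasDerivAt φ (deriv φ ζ) ζ := fun ζ hζ =>
    ((hd ζ (by simpa using hζ)).differentiableAt
      (Metric.isOpen_ball.mem_nhds (by simpa using hζ))).hasDerivAt
  -- Automorphisms taking `0` to `z` and `φ z` to `0` reduce the claim to the Schwarz lemma at the
  -- origin.
  let g : ℂ → ℂ := fun ζ => diskMobius (-φ z) (φ (diskMobius z ζ))
  have hg : ∀ ζ : ℂ, ‖ζ‖ < 1 → HasDerivAt g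
      (((1 - ‖-φ z‖ ^ 2 : ℝ) : ℂ) / (1 + conj (-φ z) * φ (diskMobius z ζ)) ^ 2 *
        (deriv φ (diskMobius z ζ) * (((1 - ‖z‖ ^ 2 : ℝ) : ℂ) / (1 + conj z * ζ) ^ 2))) ζ := by
    intro ζ hζ
    have hζ' := norm_diskMobius_lt_one hz hζ
    exact (hasDerivAt_diskMobius hma (hm _ hζ')).comp ζ
      ((hdφ _ hζ').comp ζ (hasDerivAt_diskMobius hz hζ))
  have g0 : g 0 = 0 := by simp [g, diskMobius_zero, diskMobius_neg_self]
  have hs := Complex.norm_deriv_le_one_of_mapsTo_ball (f := g) (c := 0) (R := 1)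
    (fun ζ hζ => (hg ζ (by simpa using hζ)).differentiableAt.differentiableWithinAt)
    (fun ζ hζ => by
      rw [g0]
      simpa using (norm_diskMobius_lt_one hma
        (hm _ (norm_diskMobius_lt_one hz (by simpa using hζ)))).le) one_pos
  rw [(hg 0 (by simp)).deriv, diskMobius_zero] at hs
  have h1 : 1 + conj (-φ z) * φ z = ((1 - ‖φ z‖ ^ 2 : ℝ) : ℂ) := by
    push_cast
    rw [← Complex.conj_mul' (φ z)]
    simp
    ring
  rw [h1, norm_mul, norm_mul, norm_div, norm_div, norm_pow, Complex.norm_real, Complex.norm_real,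
    Complex.norm_real, norm_neg, Real.norm_of_nonneg hpa.le, Real.norm_of_nonneg hpz.le] at hs
  simp only [mul_zero, add_zero, one_pow, norm_one, div_one] at hs
  have h2 : (1 - ‖φ z‖ ^ 2) / (1 - ‖φ z‖ ^ 2) ^ 2 * (‖deriv φ z‖ * (1 - ‖z‖ ^ 2)) =
      ((1 - ‖z‖ ^ 2) * ‖deriv φ z‖) / (1 - ‖φ z‖ ^ 2) := by
    field_simp
  rwa [h2, div_le_one hpa] at hs

/-! ### Strip maps and bounded harmonic functions. -/

/-- Divided by `|cos w|²`, this computes `1 - |tan w|²`: the tangent sends the strip `|re w| < π/4`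
into the unit disk. -/
theorem norm_sq_cos_sub_norm_sq_sin (w : ℂ) :
    ‖Complex.cos w‖ ^ 2 - ‖Complex.sin w‖ ^ 2 = Real.cos (2 * w.re) := by
  have hs : Complex.sin w = Complex.sin (w.re + w.im * Complex.I) := by rw [Complex.re_add_im]
  have hc : Complex.cos w = Complex.cos (w.re + w.im * Complex.I) := by rw [Complex.re_add_im]
  rw [hs, hc, Complex.sin_add_mul_I, Complex.cos_add_mul_I, ← Complex.ofReal_sin,
    ← Complex.ofReal_cos, ← Complex.ofReal_sinh, ← Complex.ofReal_cosh]
  have h1 := Real.sin_sq_add_cos_sq w.re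
  have h2 := Real.cosh_sq w.im
  rw [Real.cos_two_mul]
  generalize Real.sin w.re = S at *
  generalize Real.cos w.re = C at *
  generalize Real.sinh w.im = s at *
  generalize Real.cosh w.im = c at *
  simp only [Complex.sq_norm, Complex.normSq_apply]
  simp
  linear_combination (C ^ 2 - S ^ 2) * h2 - h1

/-- A holomorphic map of the disk into the strip `|re| < K` satisfies the sharp derivative bound
`(1 - |z|²) |F'(z)| ≤ 4 K / π`. -/
theorem norm_deriv_le_of_abs_re_lt {F : ℂ → ℂ} {K : ℝ}
    (hd : DifferentiableOn ℂ F (Metric.ball 0 1))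
    (hF : ∀ z : ℂ, ‖z‖ < 1 → |(F z).re| < K) {z : ℂ} (hz : ‖z‖ < 1) :
    (1 - ‖z‖ ^ 2) * ‖deriv F z‖ ≤ 4 * K / Real.pi := by
  have hK : 0 < K := (abs_nonneg _).trans_lt (hF z hz)
  have hπ := Real.pi_pos
  -- Scales the strip `|re| < K` to `|re| < π/4`.
  set c : ℝ := Real.pi / (4 * K) with hc
  have hc0 : 0 < c := by positivity
  have hcos : ∀ ζ : ℂ, ‖ζ‖ < 1 → 0 < Real.cos (2 * ((c : ℂ) * F ζ).re) := by
    intro ζ hζ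
    rw [Complex.re_ofReal_mul]
    have h1 : |2 * (c * (F ζ).re)| < Real.pi / 2 := by
      rw [abs_mul, abs_mul, abs_of_pos hc0, abs_two]
      calc 2 * (c * |(F ζ).re|) < 2 * (c * K) := by have := hF ζ hζ; gcongr
        _ = Real.pi / 2 := by rw [hc]; field_simp; ring
    exact Real.cos_pos_of_mem_Ioo ⟨(abs_lt.1 h1).1, (abs_lt.1 h1).2⟩
  have hcne : ∀ ζ : ℂ, ‖ζ‖ < 1 → Complex.cos (c * F ζ) ≠ 0 := by
    intro ζ hζ h0
    have := norm_sq_cos_sub_norm_sq_sin (c * F ζ)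
    rw [h0] at this
    have h1 := hcos ζ hζ
    rw [← this, norm_zero] at h1
    nlinarith [sq_nonneg ‖Complex.sin (c * F ζ)‖]
  have hdF : ∀ ζ : ℂ, ‖ζ‖ < 1 → HasDerivAt F (deriv F ζ) ζ := fun ζ hζ =>
    ((hd ζ (by simpa using hζ)).differentiableAt
      (Metric.isOpen_ball.mem_nhds (by simpa using hζ))).hasDerivAt
  have hdT : ∀ ζ : ℂ, ‖ζ‖ < 1 → HasDerivAt (fun ζ => Complex.tan (c * F ζ))
      (1 / Complex.cos (c * F ζ) ^ 2 * (c * deriv F ζ)) ζ := fun ζ hζ =>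
    (Complex.hasDerivAt_tan (hcne ζ hζ)).comp (h₂ := Complex.tan) ζ
      ((hdF ζ hζ).const_mul (c : ℂ))
  have hsub : ∀ ζ : ℂ, ‖ζ‖ < 1 → 1 - ‖Complex.tan (c * F ζ)‖ ^ 2 =
      Real.cos (2 * ((c : ℂ) * F ζ).re) / ‖Complex.cos (c * F ζ)‖ ^ 2 := by
    intro ζ hζ
    have := norm_ne_zero_iff.2 (hcne ζ hζ)
    rw [← norm_sq_cos_sub_norm_sq_sin, Complex.tan_eq_sin_div_cos, norm_div]
    field_simp
  have hT : ∀ ζ : ℂ, ‖ζ‖ < 1 → ‖Complex.tan (c * F ζ)‖ < 1 := by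
    intro ζ hζ
    have h0 := norm_pos_iff.2 (hcne ζ hζ)
    have h1 : 0 < 1 - ‖Complex.tan (c * F ζ)‖ ^ 2 := by
      rw [hsub ζ hζ]
      have := hcos ζ hζ
      positivity
    nlinarith [norm_nonneg (Complex.tan (c * F ζ))]
  have h := schwarzPick_deriv (φ := fun ζ => Complex.tan (c * F ζ))
    (fun ζ hζ => (hdT ζ (by simpa using hζ)).differentiableAt.differentiableWithinAt) hT hz
  rw [(hdT z hz).deriv] at h
  rw [hsub z hz, norm_mul, norm_mul, norm_div, norm_pow, norm_one, Complex.norm_real,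
    Real.norm_of_nonneg hc0.le] at h
  have h0 := norm_pos_iff.2 (hcne z hz)
  have h2 : (1 - ‖z‖ ^ 2) * (1 / ‖Complex.cos (c * F z)‖ ^ 2 * (c * ‖deriv F z‖)) =
      (c * ((1 - ‖z‖ ^ 2) * ‖deriv F z‖)) / ‖Complex.cos (c * F z)‖ ^ 2 := by ring
  rw [h2, div_le_div_iff_of_pos_right (by positivity)] at h
  have h3 : c * ((1 - ‖z‖ ^ 2) * ‖deriv F z‖) ≤ 1 := h.trans (Real.cos_le_one _)
  rw [le_div_iff₀ hπ]
  rw [hc, div_mul_eq_mul_div, div_le_one (by positivity)] at h3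
  linarith

/-- Colonna's bound for bounded complex harmonic functions on the disk. -/
theorem norm_fderiv_le_of_harmonicOnNhd {H : ℂ → ℂ} {M : ℝ}
    (hH : InnerProductSpace.HarmonicOnNhd H (Metric.ball (0 : ℂ) 1))
    (hM : ∀ z ∈ Metric.ball (0 : ℂ) 1, ‖H z‖ ≤ M) {z : ℂ} (hz : ‖z‖ < 1) (v : ℂ) :
    (1 - ‖z‖ ^ 2) * ‖fderiv ℝ H z v‖ ≤ 4 * M / Real.pi * ‖v‖ := by
  have hpz := one_sub_norm_sq_pos hz
  have hzb : z ∈ Metric.ball (0 : ℂ) 1 := by simpa using hz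
  set w := fderiv ℝ H z v with hw
  rcases eq_or_ne w 0 with h0 | h0
  · have : 0 ≤ M := (norm_nonneg _).trans (hM z hzb)
    rw [h0, norm_zero, mul_zero]
    have := Real.pi_pos
    positivity
  have hw0 : 0 < ‖w‖ := norm_pos_iff.2 h0
  -- A rotation making `c * w = ‖w‖`, so the real part of `c * H` already has the full derivative in
  -- direction `v`.
  set c : ℂ := conj w / ‖w‖ with hc
  have hcn : ‖c‖ = 1 := by
    rw [hc, norm_div, Complex.norm_conj, Complex.norm_real, norm_norm, div_self hw0.ne']
  let l : ℂ →L[ℝ] ℝ := Complex.reCLM.comp (ContinuousLinearMap.mul ℝ ℂ c)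
  have hl : ∀ x, l x = (c * x).re := fun x => rfl
  have hlw : l w = ‖w‖ := by
    have : c * w = ((‖w‖ : ℝ) : ℂ) := by
      have h1 : (‖w‖ : ℂ) ≠ 0 := by exact_mod_cast hw0.ne'
      rw [hc, div_mul_eq_mul_div, Complex.conj_mul']
      field_simp
    rw [hl, this, Complex.ofReal_re]
  obtain ⟨F, hFa, hFe⟩ := (hH.comp_CLM l).exists_analyticOnNhd_ball_re_eq
  have hFd : HasDerivAt F (deriv F z) z := (hFa z hzb).differentiableAt.hasDerivAt
  have hu : HasFDerivAt (l ∘ H) (l.comp (fderiv ℝ H z)) z :=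
    l.hasFDerivAt.comp z ((hH z hzb).1.differentiableAt two_ne_zero).hasFDerivAt
  have hu' : HasFDerivAt (l ∘ H) (Complex.reCLM.comp (fderiv ℝ F z)) z :=
    (Complex.reCLM.hasFDerivAt.comp z
      (hFd.differentiableAt.restrictScalars ℝ).hasFDerivAt).congr_of_eventuallyEq
      (Filter.eventually_of_mem (Metric.isOpen_ball.mem_nhds hzb) fun y hy => (hFe hy).symm)
  have hFv : fderiv ℝ F z v = v * deriv F z := by
    rw [hFd.differentiableAt.fderiv_restrictScalars ℝ]
    simp
  have hwF : ‖w‖ ≤ ‖deriv F z‖ * ‖v‖ := by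
    have h1 : ‖w‖ = (v * deriv F z).re := by
      rw [← hlw, ← hFv]
      exact congrArg (fun T : ℂ →L[ℝ] ℝ => T v) (hu.unique hu')
    rw [h1, mul_comm, ← norm_mul]
    exact Complex.re_le_norm _
  -- The strip bound needs a strict inequality, so it is used for `K > M` and then `K ↓ M`.
  have hK : ∀ K : ℝ, M < K → (1 - ‖z‖ ^ 2) * ‖deriv F z‖ ≤ 4 * K / Real.pi := by
    intro K hK
    refine norm_deriv_le_of_abs_re_lt hFa.differentiableOn (fun ζ hζ => ?_) hz
    have hζ' : ζ ∈ Metric.ball (0 : ℂ) 1 := by simpa using hζ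
    have h1 : (F ζ).re = (c * H ζ).re := hFe hζ'
    rw [h1]
    calc |(c * H ζ).re| ≤ ‖c * H ζ‖ := Complex.abs_re_le_norm _
      _ = ‖H ζ‖ := by rw [norm_mul, hcn, one_mul]
      _ < K := (hM ζ hζ').trans_lt hK
  have hle : (1 - ‖z‖ ^ 2) * ‖deriv F z‖ ≤ 4 * M / Real.pi := by
    have ht : Filter.Tendsto (fun K : ℝ => 4 * K / Real.pi) (nhdsWithin M (Set.Ioi M))
        (nhds (4 * M / Real.pi)) :=
      (Continuous.tendsto (by fun_prop) M).mono_left nhdsWithin_le_nhds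
    exact ge_of_tendsto ht (Filter.eventually_of_mem self_mem_nhdsWithin fun K hKM => hK K hKM)
  calc (1 - ‖z‖ ^ 2) * ‖w‖ ≤ (1 - ‖z‖ ^ 2) * (‖deriv F z‖ * ‖v‖) := by gcongr
    _ = ((1 - ‖z‖ ^ 2) * ‖deriv F z‖) * ‖v‖ := by ring
    _ ≤ 4 * M / Real.pi * ‖v‖ := by gcongr

/-! ### Hyperbolic distance and hyperbolic derivative. -/

theorem diskHypDist_eq (z w : ℂ) : diskHypDist z w =
    (1 / 2) * Real.log ((1 + ‖diskMobius (-z) w‖) / (1 - ‖diskMobius (-z) w‖)) := by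
  have h : ‖(z - w) / (1 - conj z * w)‖ = ‖diskMobius (-z) w‖ := by
    rw [diskMobius, map_neg, neg_mul, ← sub_eq_add_neg, ← sub_eq_add_neg, norm_div, norm_div,
      norm_sub_rev]
  rw [diskHypDist, h]

theorem hasDerivAt_half_log_div {r : ℝ} (hr : |r| < 1) :
    HasDerivAt (fun r : ℝ => (1 / 2) * Real.log ((1 + r) / (1 - r))) (1 / (1 - r ^ 2)) r := by
  obtain ⟨h1, h2⟩ := abs_lt.1 hr
  have h3 : 1 + r ≠ 0 := by linarith
  have h4 : 1 - r ≠ 0 := by linarith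
  have h5 : 1 - r ^ 2 ≠ 0 := by
    have : 1 - r ^ 2 = (1 + r) * (1 - r) := by ring
    rw [this]
    exact mul_ne_zero h3 h4
  have hn : HasDerivAt (fun r : ℝ => 1 + r) 1 r := (hasDerivAt_id r).const_add 1
  have hd : HasDerivAt (fun r : ℝ => 1 - r) (-1) r := (hasDerivAt_id r).const_sub 1
  refine (((hn.div hd h4).log (div_ne_zero h3 h4)).const_mul (1 / 2)).congr_deriv ?_
  rw [Pi.div_apply]
  field_simp
  ring

theorem diskHypDist_pos {z w : ℂ} (hz : ‖z‖ < 1) (hw : ‖w‖ < 1) (h : z ≠ w) :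
    0 < diskHypDist z w := by
  have hz' : ‖-z‖ < 1 := by simpa using hz
  have h1 := norm_diskMobius_lt_one hz' hw
  have h0 : 0 < ‖diskMobius (-z) w‖ := by
    refine norm_pos_iff.2 (div_ne_zero ?_ (one_add_conj_mul_ne_zero hz' hw))
    rw [← sub_eq_add_neg]
    exact sub_ne_zero.2 h.symm
  rw [diskHypDist_eq]
  have : 0 < Real.log ((1 + ‖diskMobius (-z) w‖) / (1 - ‖diskMobius (-z) w‖)) := by
    refine Real.log_pos ?_
    rw [lt_div_iff₀ (by linarith)]
    linarith
  positivity

theorem diskMobius_diskMobius_neg {z w : ℂ} (hz : ‖z‖ < 1) (hw : ‖w‖ < 1) :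
    diskMobius z (diskMobius (-z) w) = w := by
  have h1 : 1 + conj (-z) * w ≠ 0 := one_add_conj_mul_ne_zero (by simpa using hz) hw
  have h2 : 1 + conj z * diskMobius (-z) w ≠ 0 :=
    one_add_conj_mul_ne_zero hz (norm_diskMobius_lt_one (by simpa using hz) hw)
  rw [diskMobius, div_eq_iff h2, diskMobius]
  rw [map_neg] at h1 ⊢
  generalize hq : 1 + -conj z * w = q at *
  field_simp
  rw [← hq]
  ring

/-- A pointwise bound on the hyperbolic derivative is a Lipschitz bound for the hyperbolic
distance. -/
theorem norm_sub_le_mul_diskHypDist {f : ℂ → ℂ} {C : ℝ}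
    (hf : ∀ ζ : ℂ, ‖ζ‖ < 1 → DifferentiableAt ℝ f ζ)
    (hC : ∀ ζ : ℂ, ‖ζ‖ < 1 → ∀ v : ℂ, (1 - ‖ζ‖ ^ 2) * ‖fderiv ℝ f ζ v‖ ≤ C * ‖v‖)
    {z w : ℂ} (hz : ‖z‖ < 1) (hw : ‖w‖ < 1) :
    ‖f z - f w‖ ≤ C * diskHypDist z w := by
  set a := diskMobius (-z) w with ha
  have ha1 : ‖a‖ < 1 := norm_diskMobius_lt_one (by simpa using hz) hw
  have hta : ∀ t ∈ Set.Icc (0 : ℝ) 1, ‖(t : ℂ) * a‖ < 1 := by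
    intro t ht
    rw [norm_mul, Complex.norm_real, Real.norm_of_nonneg ht.1]
    nlinarith [norm_nonneg a, ht.2]
  -- The geodesic from `z` to `w`, as the image of the segment from `0` to `a`.
  let p : ℝ → ℂ := fun t => diskMobius z (t * a)
  let p' : ℝ → ℂ := fun t => ((1 - ‖z‖ ^ 2 : ℝ) : ℂ) / (1 + conj z * (t * a)) ^ 2 * a
  have hp : ∀ t ∈ Set.Icc (0 : ℝ) 1, HasDerivAt p (p' t) t := by
    intro t ht
    have h1 : HasDerivAt (fun t : ℝ => (t : ℂ) * a) a t := by
      simpa using ((hasDerivAt_id t).ofReal_comp).mul_const a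
    exact (hasDerivAt_diskMobius hz (hta t ht)).comp t h1
  have hpn : ∀ t ∈ Set.Icc (0 : ℝ) 1, ‖p t‖ < 1 := fun t ht =>
    norm_diskMobius_lt_one hz (hta t ht)
  have hg : ∀ t ∈ Set.Icc (0 : ℝ) 1,
      HasDerivAt (fun t => f (p t) - f z) (fderiv ℝ f (p t) (p' t)) t := fun t ht =>
    ((hf _ (hpn t ht)).hasFDerivAt.comp_hasDerivAt t (hp t ht)).sub_const _
  have habs : ∀ t ∈ Set.Icc (0 : ℝ) 1, |t * ‖a‖| < 1 := by
    intro t ht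
    simpa using hta t ht
  have hB : ∀ t ∈ Set.Icc (0 : ℝ) 1, HasDerivAt
      (fun t : ℝ => C * ((1 / 2) * Real.log ((1 + t * ‖a‖) / (1 - t * ‖a‖))))
      (C * (1 / (1 - (t * ‖a‖) ^ 2) * ‖a‖)) t := by
    intro t ht
    have h1 : HasDerivAt (fun t : ℝ => t * ‖a‖) ‖a‖ t := by
      simpa using (hasDerivAt_id t).mul_const ‖a‖
    exact (HasDerivAt.comp (h₂ := fun r : ℝ => (1 / 2) * Real.log ((1 + r) / (1 - r)))
      t (hasDerivAt_half_log_div (habs t ht)) h1).const_mul C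
  have hbound : ∀ t ∈ Set.Icc (0 : ℝ) 1, ‖fderiv ℝ f (p t) (p' t)‖ ≤
      C * (1 / (1 - (t * ‖a‖) ^ 2) * ‖a‖) := by
    intro t ht
    have h1 := hC (p t) (hpn t ht) (p' t)
    have h2 : 1 - ‖p t‖ ^ 2 = _ := one_sub_norm_sq_diskMobius hz (hta t ht)
    have h3 := one_sub_norm_sq_pos hz
    have h4 := one_sub_norm_sq_pos (hta t ht)
    have h5 := norm_pos_iff.2 (one_add_conj_mul_ne_zero hz (hta t ht))
    have h6 : ‖p' t‖ = (1 - ‖z‖ ^ 2) / ‖1 + conj z * (t * a)‖ ^ 2 * ‖a‖ := by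
      simp only [p']
      rw [norm_mul, norm_div, norm_pow, Complex.norm_real, Real.norm_of_nonneg h3.le]
    rw [h6, h2] at h1
    have h7 : ‖(t : ℂ) * a‖ = t * ‖a‖ := by
      rw [norm_mul, Complex.norm_real, Real.norm_of_nonneg ht.1]
    rw [h7] at h1 h4
    set q := ‖1 + conj z * (t * a)‖
    set d := ‖fderiv ℝ f (p t) (p' t)‖
    -- Invariance of the hyperbolic metric: the factor `(1 - |z|²) / q²` occurs on both sides and
    -- cancels.
    have h8 : (1 - ‖z‖ ^ 2) / q ^ 2 * ((1 - (t * ‖a‖) ^ 2) * d) ≤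
        (1 - ‖z‖ ^ 2) / q ^ 2 * (C * ‖a‖) := by
      calc _ = (1 - ‖z‖ ^ 2) * (1 - (t * ‖a‖) ^ 2) / q ^ 2 * d := by ring
        _ ≤ _ := h1
        _ = _ := by ring
    have h9 := le_of_mul_le_mul_left h8 (by positivity)
    calc d ≤ C * ‖a‖ / (1 - (t * ‖a‖) ^ 2) := by
          rw [le_div_iff₀ h4]
          linarith
      _ = _ := by ring
  have key := image_norm_le_of_norm_deriv_right_le_deriv_boundary' (a := 0) (b := 1)
    (fun t ht => (hg t ht).continuousAt.continuousWithinAt)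
    (fun t ht => (hg t (Set.Ico_subset_Icc_self ht)).hasDerivWithinAt)
    (by simp [p, diskMobius_zero])
    (fun t ht => (hB t ht).continuousAt.continuousWithinAt)
    (fun t ht => (hB t (Set.Ico_subset_Icc_self ht)).hasDerivWithinAt)
    (fun t ht => hbound t (Set.Ico_subset_Icc_self ht)) (Set.right_mem_Icc.2 zero_le_one)
  have hp1 : p 1 = w := by
    simp only [p, Complex.ofReal_one, one_mul]
    exact diskMobius_diskMobius_neg hz hw
  rw [hp1, one_mul] at key
  rw [norm_sub_rev, diskHypDist_eq]
  exact key

theorem norm_sub_le_blochNumber_mul_diskHypDist {f : ℂ → ℂ} (hB : blochNumber f < ⊤) {z w : ℂ}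
    (hz : ‖z‖ < 1) (hw : ‖w‖ < 1) :
    ‖f z - f w‖ ≤ (blochNumber f).toReal * diskHypDist z w := by
  rcases eq_or_ne z w with rfl | h
  · simp [diskHypDist]
  have h1 : ENNReal.ofReal (‖f z - f w‖ / diskHypDist z w) ≤ blochNumber f :=
    le_iSup₂_of_le z (by simpa using hz) (le_iSup₂_of_le w (by simpa using hw) (le_iSup_of_le h le_rfl))
  rw [ENNReal.ofReal_le_iff_le_toReal hB.ne] at h1
  exact (div_le_iff₀ (diskHypDist_pos hz hw h)).1 h1

/-- The hyperbolic derivative is bounded by the Bloch number. -/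
theorem norm_fderiv_le_blochNumber {f : ℂ → ℂ} (hB : blochNumber f < ⊤) {z : ℂ} (hz : ‖z‖ < 1)
    (hf : DifferentiableAt ℝ f z) (v : ℂ) :
    (1 - ‖z‖ ^ 2) * ‖fderiv ℝ f z v‖ ≤ (blochNumber f).toReal * ‖v‖ := by
  have hpz := one_sub_norm_sq_pos hz
  set b := (blochNumber f).toReal
  let q : ℝ → ℝ := fun t => ‖1 - conj z * (z + t * v)‖
  have hq0 : q 0 = 1 - ‖z‖ ^ 2 := by
    have : 1 - conj z * (z + ((0 : ℝ) : ℂ) * v) = ((1 - ‖z‖ ^ 2 : ℝ) : ℂ) := by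
      push_cast
      rw [← Complex.conj_mul' z]
      ring
    simp only [q]
    rw [this, Complex.norm_real, Real.norm_of_nonneg hpz.le]
  have hqc : Continuous q := by
    unfold q
    fun_prop
  have hline : HasDerivAt (fun t : ℝ => z + (t : ℂ) * v) v 0 := by
    simpa using (((hasDerivAt_id (0 : ℝ)).ofReal_comp).mul_const v).const_add z
  have hfl : HasDerivAt (fun t : ℝ => f (z + (t : ℂ) * v)) (fderiv ℝ f z v) 0 := by
    have h1 : HasFDerivAt f (fderiv ℝ f z) (z + ((0 : ℝ) : ℂ) * v) := by
      simpa using hf.hasFDerivAt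
    exact h1.comp_hasDerivAt (0 : ℝ) hline
  -- For small `t > 0` this is the pseudo-hyperbolic distance from `z` to `z + t v`; using `t` in
  -- place of `|t|` makes it differentiable at `0`.
  let s : ℝ → ℝ := fun t => t * ‖v‖ / q t
  have hs : HasDerivAt s (‖v‖ / (1 - ‖z‖ ^ 2)) 0 := by
    rw [hasDerivAt_iff_tendsto_slope]
    have h1 : Filter.Tendsto (fun t => ‖v‖ / q t) (nhdsWithin 0 {0}ᶜ)
        (nhds (‖v‖ / (1 - ‖z‖ ^ 2))) := by
      rw [← hq0]
      exact ((continuousAt_const.div hqc.continuousAt (by rw [hq0]; exact hpz.ne')).tendsto).mono_left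
        nhdsWithin_le_nhds
    refine h1.congr' (Filter.eventually_of_mem self_mem_nhdsWithin fun t ht => ?_)
    have ht : t ≠ 0 := ht
    simp only [slope_def_field, s, zero_mul, zero_div, sub_zero]
    field_simp
  have hρ : HasDerivAt (fun t => (1 / 2) * Real.log ((1 + s t) / (1 - s t)))
      (‖v‖ / (1 - ‖z‖ ^ 2)) 0 := by
    have h1 : HasDerivAt (fun r : ℝ => (1 / 2) * Real.log ((1 + r) / (1 - r))) 1 (s 0) := by
      have : s 0 = 0 := by simp [s]
      rw [this]
      simpa using hasDerivAt_half_log_div (r := 0) (by simp)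
    exact (HasDerivAt.comp (h₂ := fun r : ℝ => (1 / 2) * Real.log ((1 + r) / (1 - r)))
      0 h1 hs).congr_deriv (one_mul _)
  have hle : ∀ᶠ t : ℝ in nhdsWithin 0 (Set.Ioi 0),
      ‖slope (fun t : ℝ => f (z + (t : ℂ) * v)) 0 t‖ ≤
        b * slope (fun t => (1 / 2) * Real.log ((1 + s t) / (1 - s t))) 0 t := by
    have hball : ∀ᶠ t : ℝ in nhdsWithin 0 (Set.Ioi 0), ‖z + (t : ℂ) * v‖ < 1 := by
      refine Filter.Eventually.filter_mono nhdsWithin_le_nhds ?_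
      refine (Continuous.continuousAt (by fun_prop)).eventually_lt_const ?_
      simpa using hz
    filter_upwards [hball, self_mem_nhdsWithin] with t ht ht0
    have ht0 : 0 < t := ht0
    have h1 := norm_sub_le_blochNumber_mul_diskHypDist hB hz ht
    have h2 : ‖(z - (z + t * v)) / (1 - conj z * (z + t * v))‖ = s t := by
      rw [norm_div, sub_add_cancel_left, norm_neg, norm_mul, Complex.norm_real,
        Real.norm_of_nonneg ht0.le]
    rw [diskHypDist, h2, norm_sub_rev] at h1
    have h3 : s 0 = 0 := by simp [s]
    rw [slope_def_module, slope_def_field, norm_smul, h3]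
    simp only [Complex.ofReal_zero, zero_mul, add_zero, sub_zero, div_one, Real.log_one, mul_zero,
      norm_inv, Real.norm_of_nonneg ht0.le]
    rw [inv_mul_eq_div, ← mul_div_assoc]
    gcongr
  have hmono : nhdsWithin (0 : ℝ) (Set.Ioi 0) ≤ nhdsWithin 0 {0}ᶜ :=
    nhdsWithin_mono 0 fun t ht => ne_of_gt ht
  have hlim := le_of_tendsto_of_tendsto
    ((hasDerivAt_iff_tendsto_slope.1 hfl).mono_left hmono).norm
    (((hasDerivAt_iff_tendsto_slope.1 hρ).mono_left hmono).const_mul b) hle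
  rw [← mul_div_assoc, le_div_iff₀ hpz] at hlim
  linarith

/-! ### Wirtinger derivatives and the biharmonic product rule. -/

theorem fderiv_eq_wirtinger (f : ℂ → ℂ) (z v : ℂ) :
    fderiv ℝ f z v = wirtingerZ f z * v + wirtingerZBar f z * conj v := by
  have h : fderiv ℝ f z v = v.re * fderiv ℝ f z 1 + v.im * fderiv ℝ f z Complex.I := by
    conv_lhs => rw [(by simp : v = v.re • (1 : ℂ) + v.im • Complex.I)]
    rw [map_add, map_smul, map_smul, Complex.real_smul, Complex.real_smul]
  have hv : v = v.re + v.im * Complex.I := (Complex.re_add_im v).symm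
  have hc : conj v = v.re - v.im * Complex.I := by
    apply Complex.ext <;> simp
  rw [h, wirtingerZ, wirtingerZBar, hc]
  nth_rw 3 [hv]
  linear_combination (v.im * fderiv ℝ f z Complex.I) * Complex.I_sq

theorem norm_add_norm_le_of_forall_norm_le {a b : ℂ} {K : ℝ}
    (h : ∀ v : ℂ, ‖v‖ = 1 → ‖a * v + b * conj v‖ ≤ K) : ‖a‖ + ‖b‖ ≤ K := by
  -- With this angle `a v` and `b v̄` share the argument `(arg a + arg b) / 2`, so their moduli add.
  set θ : ℝ := (b.arg - a.arg) / 2 with hθ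
  have h1 := h (Complex.exp (θ * Complex.I)) (Complex.norm_exp_ofReal_mul_I θ)
  have h2 : a * Complex.exp (θ * Complex.I) + b * conj (Complex.exp (θ * Complex.I)) =
      ((‖a‖ + ‖b‖ : ℝ) : ℂ) * Complex.exp (((a.arg + b.arg) / 2 : ℝ) * Complex.I) := by
    rw [← Complex.exp_conj]
    have hmul : ∀ c x : ℂ, c * Complex.exp x = ‖c‖ * Complex.exp (c.arg * Complex.I + x) := by
      intro c x
      rw [Complex.exp_add, ← mul_assoc, Complex.norm_mul_exp_arg_mul_I]
    rw [hmul a, hmul b]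
    push_cast
    rw [add_mul]
    congr 3
    · rw [hθ]
      push_cast
      ring
    · rw [map_mul, Complex.conj_ofReal, Complex.conj_I, hθ]
      push_cast
      ring
  rwa [h2, norm_mul, Complex.norm_exp_ofReal_mul_I, mul_one, Complex.norm_real,
    Real.norm_of_nonneg (by positivity)] at h1

/-- Since `|z̄ g| = |z g|`, one has `|a| ≤ |a + z̄ g| + |z g|` and `|z g| ≤ |b + z g| + |b|`; add
these, then exchange the roles. -/
theorem abs_norm_sub_norm_le_of_add_le {a b g z : ℂ} {K : ℝ}
    (h : ‖a + conj z * g‖ + ‖b + z * g‖ ≤ K) : |‖a‖ - ‖b‖| ≤ K := by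
  have hn : ‖conj z * g‖ = ‖z * g‖ := by simp
  have h1 : ‖a‖ ≤ ‖a + conj z * g‖ + ‖conj z * g‖ := by
    simpa using norm_sub_le (a + conj z * g) (conj z * g)
  have h2 : ‖b‖ ≤ ‖b + z * g‖ + ‖z * g‖ := by
    simpa using norm_sub_le (b + z * g) (z * g)
  have h3 : ‖conj z * g‖ ≤ ‖a + conj z * g‖ + ‖a‖ := by
    simpa using norm_sub_le (a + conj z * g) a
  have h4 : ‖z * g‖ ≤ ‖b + z * g‖ + ‖b‖ := by
    simpa using norm_sub_le (b + z * g) b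
  rw [abs_le]
  constructor <;> linarith

theorem fderiv_biharmonic_apply {f H G : ℂ → ℂ} {z : ℂ} (hz : ‖z‖ < 1)
    (hH : DifferentiableAt ℝ H z) (hG : DifferentiableAt ℝ G z)
    (hf : ∀ z ∈ Metric.ball (0 : ℂ) 1, f z = H z + (‖z‖ : ℂ) ^ 2 * G z) :
    DifferentiableAt ℝ f z ∧ ∀ v : ℂ, fderiv ℝ f z v = fderiv ℝ H z v +
      (‖z‖ : ℂ) ^ 2 * fderiv ℝ G z v + (conj z * v + z * conj v) * G z := by
  have hid : HasFDerivAt (fun z : ℂ => z) (ContinuousLinearMap.id ℝ ℂ) z := hasFDerivAt_id z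
  have hcj : HasFDerivAt (fun z : ℂ => conj z) (Complex.conjCLE : ℂ →L[ℝ] ℂ) z :=
    Complex.conjCLE.hasFDerivAt
  have h := hH.hasFDerivAt.add ((hcj.mul hid).mul hG.hasFDerivAt)
  have hfe : f =ᶠ[nhds z] fun z => H z + conj z * z * G z := by
    have hzb : z ∈ Metric.ball (0 : ℂ) 1 := by simpa using hz
    refine Filter.eventually_of_mem (Metric.isOpen_ball.mem_nhds hzb) fun y hy => ?_
    simp only [hf y hy, Complex.conj_mul']
  have h' := HasFDerivAt.congr_of_eventuallyEq h hfe
  refine ⟨h'.differentiableAt, fun v => ?_⟩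
  rw [h'.fderiv, ← Complex.conj_mul']
  simp
  ring

/-! ### The extremal cubic and its maximum. -/

theorem rpow_three_halves {y : ℝ} (hy : 0 ≤ y) : y ^ (3 / 2 : ℝ) = Real.sqrt y ^ 3 := by
  rw [Real.sqrt_eq_rpow, ← Real.rpow_natCast (y ^ (1 / 2 : ℝ)) 3, ← Real.rpow_mul hy]
  norm_num

/-- The maximum is at the positive critical point `r`, a root of `3 r² = 4 r / π + 1`. The gap
factors as `(x - r)²` times a linear term, nonnegative because `x ≥ 0` and `s ≥ 1`. -/
theorem biharmonic_cubic_le {x : ℝ} (hx : 0 ≤ x) :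
    4 / Real.pi * (1 + x ^ 2) + 2 * x * (1 - x ^ 2) ≤ 4 / (27 * Real.pi ^ 3) *
      (8 + 36 * Real.pi ^ 2 + (4 + 3 * Real.pi ^ 2) ^ (3 / 2 : ℝ)) := by
  have hπ := Real.pi_pos
  set p := Real.pi
  set s := Real.sqrt (4 + 3 * p ^ 2) with hs
  have hs0 : 0 ≤ s := Real.sqrt_nonneg _
  have hs2 : s ^ 2 = 4 + 3 * p ^ 2 := Real.sq_sqrt (by positivity)
  have hpow : (4 + 3 * p ^ 2) ^ (3 / 2 : ℝ) = s ^ 3 := rpow_three_halves (by positivity)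
  rw [hpow]
  set r := (2 + s) / (3 * p) with hr
  have hr0 : 0 ≤ r := by positivity
  have hr2 : 3 * r ^ 2 = 4 * r / p + 1 := by
    rw [hr]
    field_simp
    linear_combination hs2
  have hval : 4 / (27 * p ^ 3) * (8 + 36 * p ^ 2 + s ^ 3) = 4 / p + 4 * r ^ 3 - 4 * r ^ 2 / p := by
    rw [hr]
    field_simp
    linear_combination (-81) * hs2
  have hid : 4 / (27 * p ^ 3) * (8 + 36 * p ^ 2 + s ^ 3) -
      (4 / p * (1 + x ^ 2) + 2 * x * (1 - x ^ 2)) =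
      (x - r) ^ 2 * (2 * x + 4 * s / (3 * p) - 4 / (3 * p)) := by
    have h1 : 4 * s / (3 * p) - 4 / (3 * p) = 4 * r - 4 / p := by
      rw [hr]
      field_simp
      ring
    rw [hval, add_sub_assoc (2 * x), h1]
    linear_combination (2 * x) * hr2
  have hs1 : 1 ≤ s := by nlinarith
  have h1 : 4 / (3 * p) ≤ 4 * s / (3 * p) := by
    gcongr
    linarith
  nlinarith [mul_nonneg (sq_nonneg (x - r)) (by linarith : 0 ≤ 2 * x + 4 * s / (3 * p) - 4 / (3 * p))]

theorem abs_biharmonic_constant_sub_lt :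
    |4 / (27 * Real.pi ^ 3) *
        (8 + 36 * Real.pi ^ 2 + (4 + 3 * Real.pi ^ 2) ^ (3 / 2 : ℝ)) - 2.67| < 0.005 := by
  have h1 := Real.pi_gt_d4
  have h2 := Real.pi_lt_d4
  have hπ := Real.pi_pos
  set p := Real.pi
  set s := Real.sqrt (4 + 3 * p ^ 2) with hs
  have hs0 : 0 ≤ s := Real.sqrt_nonneg _
  have hs2 : s ^ 2 = 4 + 3 * p ^ 2 := Real.sq_sqrt (by positivity)
  have hpow : (4 + 3 * p ^ 2) ^ (3 / 2 : ℝ) = s ^ 3 := rpow_three_halves (by positivity)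
  -- The constant is about `2.6669`, so the lower limit `2.665` dictates the precision.
  have hp2l : 9.8690 < p ^ 2 := by nlinarith
  have hp2u : p ^ 2 < 9.8697 := by nlinarith
  have hp3l : 31.003 < p ^ 3 := by nlinarith
  have hp3u : p ^ 3 < 31.008 := by nlinarith
  have hsl : 5.797 < s := by nlinarith
  have hsu : s < 5.7976 := by nlinarith
  have hs3l : 194.8 < s ^ 3 := by
    have : s ^ 3 = s * (4 + 3 * p ^ 2) := by rw [← hs2]; ring
    rw [this]; nlinarith
  have hs3u : s ^ 3 < 194.9 := by
    have : s ^ 3 = s * (4 + 3 * p ^ 2) := by rw [← hs2]; ring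
    rw [this]; nlinarith
  rw [hpow, div_mul_eq_mul_div, abs_lt]
  constructor
  · rw [lt_sub_iff_add_lt, lt_div_iff₀ (by positivity)]
    linarith
  · rw [sub_lt_iff_lt_add, div_lt_iff₀ (by positivity)]
    linarith

/-! ### Assembling both bounds. -/

/-- The hyperbolic derivative of a biharmonic mapping with bounded harmonic parts. -/
theorem norm_fderiv_biharmonic_le {f H G : ℂ → ℂ} {M : ℝ}
    (hH : InnerProductSpace.HarmonicOnNhd H (Metric.ball (0 : ℂ) 1))
    (hG : InnerProductSpace.HarmonicOnNhd G (Metric.ball (0 : ℂ) 1))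
    (hf : ∀ z ∈ Metric.ball (0 : ℂ) 1, f z = H z + (‖z‖ : ℂ) ^ 2 * G z)
    (hHM : ∀ z ∈ Metric.ball (0 : ℂ) 1, ‖H z‖ ≤ M)
    (hGM : ∀ z ∈ Metric.ball (0 : ℂ) 1, ‖G z‖ ≤ M) {z : ℂ} (hz : ‖z‖ < 1) (v : ℂ) :
    (1 - ‖z‖ ^ 2) * ‖fderiv ℝ f z v‖ ≤ 4 * M / (27 * Real.pi ^ 3) *
        (8 + 36 * Real.pi ^ 2 + (4 + 3 * Real.pi ^ 2) ^ (3 / 2 : ℝ)) * ‖v‖ := by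
  have hzb : z ∈ Metric.ball (0 : ℂ) 1 := by simpa using hz
  have hM : 0 ≤ M := (norm_nonneg _).trans (hHM z hzb)
  have hp := one_sub_norm_sq_pos hz
  rw [(fderiv_biharmonic_apply hz ((hH z hzb).1.differentiableAt two_ne_zero)
    ((hG z hzb).1.differentiableAt two_ne_zero) hf).2 v]
  have h1 := norm_fderiv_le_of_harmonicOnNhd hH hHM hz v
  have h2 := norm_fderiv_le_of_harmonicOnNhd hG hGM hz v
  have h3 : ‖(conj z * v + z * conj v) * G z‖ ≤ 2 * ‖z‖ * ‖v‖ * M := by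
    rw [norm_mul]
    have h4 : ‖conj z * v + z * conj v‖ ≤ 2 * ‖z‖ * ‖v‖ := by
      refine (norm_add_le _ _).trans_eq ?_
      rw [norm_mul, norm_mul, Complex.norm_conj, Complex.norm_conj]
      ring
    exact mul_le_mul h4 (hGM z hzb) (norm_nonneg _) (by positivity)
  have h5 : ‖fderiv ℝ H z v + (‖z‖ : ℂ) ^ 2 * fderiv ℝ G z v + (conj z * v + z * conj v) * G z‖ ≤
      ‖fderiv ℝ H z v‖ + ‖z‖ ^ 2 * ‖fderiv ℝ G z v‖ + 2 * ‖z‖ * ‖v‖ * M := by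
    refine (norm_add₃_le).trans ?_
    rw [norm_mul ((‖z‖ : ℂ) ^ 2), norm_pow, Complex.norm_real, norm_norm]
    gcongr
  calc _ ≤ (1 - ‖z‖ ^ 2) * (‖fderiv ℝ H z v‖ + ‖z‖ ^ 2 * ‖fderiv ℝ G z v‖ +
        2 * ‖z‖ * ‖v‖ * M) := by gcongr
    _ = (1 - ‖z‖ ^ 2) * ‖fderiv ℝ H z v‖ + ‖z‖ ^ 2 * ((1 - ‖z‖ ^ 2) * ‖fderiv ℝ G z v‖) +
        2 * ‖z‖ * (1 - ‖z‖ ^ 2) * (M * ‖v‖) := by ring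
    _ ≤ 4 * M / Real.pi * ‖v‖ + ‖z‖ ^ 2 * (4 * M / Real.pi * ‖v‖) +
        2 * ‖z‖ * (1 - ‖z‖ ^ 2) * (M * ‖v‖) := by gcongr
    _ = (4 / Real.pi * (1 + ‖z‖ ^ 2) + 2 * ‖z‖ * (1 - ‖z‖ ^ 2)) * (M * ‖v‖) := by ring
    _ ≤ (4 / (27 * Real.pi ^ 3) * (8 + 36 * Real.pi ^ 2 +
        (4 + 3 * Real.pi ^ 2) ^ (3 / 2 : ℝ))) * (M * ‖v‖) :=
      mul_le_mul_of_nonneg_right (biharmonic_cubic_le (norm_nonneg z)) (by positivity)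
    _ = _ := by ring

theorem mainTheorem9 (f H G : ℂ → ℂ)
    (hH : InnerProductSpace.HarmonicOnNhd H (Metric.ball (0 : ℂ) 1))
    (hG : InnerProductSpace.HarmonicOnNhd G (Metric.ball (0 : ℂ) 1))
    (hf : ∀ z ∈ Metric.ball (0 : ℂ) 1, f z = H z + (‖z‖ : ℂ) ^ 2 * G z)
    (hB : blochNumber f < ⊤) :
    (⨆ z ∈ Metric.ball (0 : ℂ) 1, ENNReal.ofReal ((1 - ‖z‖ ^ 2) *
        |‖wirtingerZ H z + (‖z‖ : ℂ) ^ 2 * wirtingerZ G z‖ -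
          ‖wirtingerZBar H z + (‖z‖ : ℂ) ^ 2 * wirtingerZBar G z‖|)) ≤ blochNumber f ∧
    (∀ M : ℝ, (∀ z ∈ Metric.ball (0 : ℂ) 1, ‖H z‖ ≤ M) →
      (∀ z ∈ Metric.ball (0 : ℂ) 1, ‖G z‖ ≤ M) →
      blochNumber f ≤ ENNReal.ofReal (4 * M / (27 * Real.pi ^ 3) *
        (8 + 36 * Real.pi ^ 2 + (4 + 3 * Real.pi ^ 2) ^ (3 / 2 : ℝ)))) ∧
    |4 / (27 * Real.pi ^ 3) *
        (8 + 36 * Real.pi ^ 2 + (4 + 3 * Real.pi ^ 2) ^ (3 / 2 : ℝ)) - 2.67| < 0.005 := by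
  have hd : ∀ z : ℂ, ‖z‖ < 1 → DifferentiableAt ℝ f z ∧ ∀ v : ℂ, fderiv ℝ f z v =
      fderiv ℝ H z v + (‖z‖ : ℂ) ^ 2 * fderiv ℝ G z v + (conj z * v + z * conj v) * G z := by
    intro z hz
    have hzb : z ∈ Metric.ball (0 : ℂ) 1 := by simpa using hz
    exact fderiv_biharmonic_apply hz ((hH z hzb).1.differentiableAt two_ne_zero)
      ((hG z hzb).1.differentiableAt two_ne_zero) hf
  refine ⟨iSup₂_le fun z hzb => ?_, fun M hHM hGM => ?_, abs_biharmonic_constant_sub_lt⟩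
  · have hz : ‖z‖ < 1 := by simpa using hzb
    have hp := one_sub_norm_sq_pos hz
    rw [ENNReal.ofReal_le_iff_le_toReal hB.ne, mul_comm, ← le_div_iff₀ hp]
    refine abs_norm_sub_norm_le_of_add_le (z := z) (g := G z) (norm_add_norm_le_of_forall_norm_le ?_)
    intro v hv
    have h1 := norm_fderiv_le_blochNumber hB hz (hd z hz).1 v
    rw [(hd z hz).2 v, fderiv_eq_wirtinger H, fderiv_eq_wirtinger G, hv, mul_one] at h1
    rw [le_div_iff₀ hp, mul_comm]
    refine le_of_eq_of_le (congrArg (fun x : ℂ => (1 - ‖z‖ ^ 2) * ‖x‖) ?_) h1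
    ring
  · refine iSup₂_le fun z hzb => iSup₂_le fun w hwb => iSup_le fun hzw => ?_
    have hz : ‖z‖ < 1 := by simpa using hzb
    have hw : ‖w‖ < 1 := by simpa using hwb
    refine ENNReal.ofReal_le_ofReal ?_
    rw [div_le_iff₀ (diskHypDist_pos hz hw hzw)]
    exact norm_sub_le_mul_diskHypDist (fun ζ hζ => (hd ζ hζ).1)
      (fun ζ hζ v => norm_fderiv_biharmonic_le hH hG hf hHM hGM hζ v) hz hw
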